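/- For a centered real Gaussian process $X=\{X_t\}_{t\ge 0}$, let $R(s,t)=\mathbb E[X_sX_t]$ and let $\mathbb H(X)$ be the reproducing kernel Hilbert space of its restriction to $[0,1]$, i.e. the space of functions on $[0,1]$ obtained by completing the linear span of $\{R(s,\cdot): s\in[0,1]\}$ under the norm induced by $\langle R(s,\cdot),R(t,\cdot)\rangle=R(s,t)$. For $H\in(0,1)$, a fractional Brownian motion $B^H$ is a centered Gaussian process $\{B^H_t\}_{t\ge0}$ with $$\mathbb E[B^H_tB^H_s]=\tfrac12\left(t^{2H}+s^{2H}-|t-s|^{2H}\right),$$ and, for $H\in(0,1)$ and $K\in(0,1]$, a bi-fractional Brownian motion $Z^{H,K}$ is a centered Gaussian process $\{Z^{H,K}_t\}_{t\ge0}$ with $$\mathbb E[Z^{H,K}_tZ^{H,K}_s]=\frac1{2^K}\left((t^{2H}+s^{2H})^K-|t-s|^{2HK}\right).$$ For $\alpha>\frac12$, let $I^{\alpha}_{0+}(L^2[0,1])$ be the set of functions $t\mapsto\frac1{\Gamma(\alpha)}\int_0^t(t-s)^{\alpha-1}g(s)\,ds$, $t\in[0,1]$, with $g\in L^2[0,1]$.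 **Proposition.** Let $H,K\in(0,1)$. Then, as sets of functions on $[0,1]$, $$\mathbb H(B^H)\subseteq\mathbb H(Z^{H,K})\subseteq\mathbb H(B^{HK}),$$ where $B^{HK}$ is a fractional Brownian motion with Hurst parameter $HK$. In particular, $$I^{3/2}_{0+}(L^2[0,1])\subseteq\mathbb H(B^H)\subseteq\mathbb H(Z^{H,K}).$$ -/

import Mathlib

open MeasureTheory ProbabilityTheory Set
open scoped NNReal unitInterval

namespace BiFBm

/-- The covariance function `R(s,t) = E[X_s X_t]` of a centered process. -/
noncomputable def covFun {T Ω : Type*} {mΩ : MeasurableSpace Ω} (X : T → Ω → ℝ) (P : Measure Ω)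
    (s t : T) : ℝ :=
  ∫ ω, X s ω * X t ω ∂P

/-- The real kernel `R(s,t)`, viewed as an operator-valued kernel: each number `R(s,t)` acts on
`ℝ` by multiplication. -/
noncomputable def covMatrix {T Ω : Type*} {mΩ : MeasurableSpace Ω} (X : T → Ω → ℝ)
    (P : Measure Ω) : Matrix T T (ℝ →L[ℝ] ℝ) :=
  Matrix.of fun s t ↦ covFun X P s t • ContinuousLinearMap.id ℝ ℝ

theorem covMatrix_posSemidef {T Ω : Type*} {mΩ : MeasurableSpace Ω} {X : T → Ω → ℝ}
    {P : Measure Ω} (hX : ∀ t, MemLp (X t) 2 P) : (covMatrix X P).PosSemidef := by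
  have h := (RKHS.posSemidef_tfae (K := covMatrix X P)).out 0 2
  refine h.mpr ⟨?_, fun v ↦ ?_⟩
  · ext s t
    have hid : ContinuousLinearMap.adjoint (ContinuousLinearMap.id ℝ ℝ) =
        ContinuousLinearMap.id ℝ ℝ := star_one (ℝ →L[ℝ] ℝ)
    simp [covMatrix, covFun, mul_comm, ContinuousLinearMap.star_eq_adjoint, hid]
  · have hint : ∀ s t, Integrable (fun ω ↦ X s ω * X t ω) P :=
      fun s t ↦ (hX s).integrable_mul (hX t)
    have hint' : ∀ s t, Integrable (fun ω ↦ v s * X s ω * (v t * X t ω)) P := fun s t ↦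
      ((hint s t).const_mul (v s * v t)).congr (ae_of_all _ fun ω ↦ by simp only; ring)
    have key : (v.sum fun x w ↦ v.sum fun x' w' ↦ inner ℝ (covMatrix X P x' x w) w')
        = ∫ ω, (v.sum fun x w ↦ w * X x ω) ^ 2 ∂P := by
      simp only [Finsupp.sum, sq, Finset.sum_mul_sum]
      rw [integral_finsetSum _ fun s _ ↦ integrable_finsetSum _ fun t _ ↦ hint' s t]
      refine Finset.sum_congr rfl fun s _ ↦ ?_
      rw [integral_finsetSum _ fun t _ ↦ hint' s t]
      refine Finset.sum_congr rfl fun t _ ↦ ?_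
      have : ∀ ω, v s * X s ω * (v t * X t ω) = (v s * v t) * (X t ω * X s ω) :=
        fun ω ↦ by ring
      simp only [this, integral_const_mul]
      simp [covMatrix, covFun, mul_comm, mul_left_comm, mul_assoc]
    rw [key]
    exact integral_nonneg fun ω ↦ sq_nonneg _

theorem memLp_two {T Ω : Type*} {mΩ : MeasurableSpace Ω} {X : T → Ω → ℝ} {P : Measure Ω}
    (hX : IsGaussianProcess X P) (t : T) : MemLp (X t) 2 P :=
  (hX.hasGaussianLaw_eval t).memLp_two

/-- The reproducing kernel Hilbert space of a Gaussian process `X` with index set `T`, as a set of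
functions on `T`: the completion of the span of the functions `R(s, ·)` for the inner product with
`⟨R(s, ·), R(t, ·)⟩ = R(s, t)`, each element being identified with the function on `T` given by
the reproducing property. -/
def processRKHS {T Ω : Type*} {mΩ : MeasurableSpace Ω} {X : T → Ω → ℝ} {P : Measure Ω}
    (hX : IsGaussianProcess X P) : Set (T → ℝ) :=
  haveI : Fact (covMatrix X P).PosSemidef := ⟨covMatrix_posSemidef (memLp_two hX)⟩
  range fun (f : RKHS.OfKernel (covMatrix X P)) (t : T) ↦ f t

theorem isGaussianProcess_restrict {Ω : Type*} {mΩ : MeasurableSpace Ω} {X : ℝ≥0 → Ω → ℝ}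
    {P : Measure Ω} (hX : IsGaussianProcess X P) :
    IsGaussianProcess (fun t : I ↦ X (unitInterval.toNNReal t)) P :=
  hX.comp_right unitInterval.toNNReal

/-- The reproducing kernel Hilbert space of the restriction `{X_t, 0 ≤ t ≤ 1}` to the unit interval
of a Gaussian process `{X_t, t ≥ 0}`. -/
def unitRKHS {Ω : Type*} {mΩ : MeasurableSpace Ω} {X : ℝ≥0 → Ω → ℝ} {P : Measure Ω}
    (hX : IsGaussianProcess X P) : Set (I → ℝ) :=
  processRKHS (isGaussianProcess_restrict hX)

/-- `{X_t, t ≥ 0}` is a fractional Brownian motion with Hurst parameter `H`. -/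
structure IsFBm {Ω : Type*} {mΩ : MeasurableSpace Ω} (H : ℝ) (X : ℝ≥0 → Ω → ℝ)
    (P : Measure Ω) : Prop where
  isGaussianProcess : IsGaussianProcess X P
  centered : ∀ t, ∫ ω, X t ω ∂P = 0
  cov : ∀ s t : ℝ≥0, ∫ ω, X t ω * X s ω ∂P =
    1 / 2 * ((t : ℝ) ^ (2 * H) + (s : ℝ) ^ (2 * H) - |(t : ℝ) - s| ^ (2 * H))

/-- `{X_t, t ≥ 0}` is a bi-fractional Brownian motion with parameters `H` and `K`. -/
structure IsBiFBm {Ω : Type*} {mΩ : MeasurableSpace Ω} (H K : ℝ) (X : ℝ≥0 → Ω → ℝ)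
    (P : Measure Ω) : Prop where
  isGaussianProcess : IsGaussianProcess X P
  centered : ∀ t, ∫ ω, X t ω ∂P = 0
  cov : ∀ s t : ℝ≥0, ∫ ω, X t ω * X s ω ∂P =
    1 / (2 : ℝ) ^ K * (((t : ℝ) ^ (2 * H) + (s : ℝ) ^ (2 * H)) ^ K
      - |(t : ℝ) - s| ^ (2 * H * K))

/-- The left-sided Riemann-Liouville fractional integral of order `α`. -/
noncomputable def fracIntegral (α : ℝ) (g : ℝ → ℝ) (t : ℝ) : ℝ :=
  1 / Real.Gamma α * ∫ s in (0 : ℝ)..t, (t - s) ^ (α - 1) * g s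

/-- The image of `L²[0,1]` under the fractional integral of order `α`, as a set of functions on
`[0,1]`. For `α > 1/2` the integral converges at every `t ∈ [0,1]`, so that these are functions
defined everywhere. -/
def fracImage (α : ℝ) : Set (I → ℝ) :=
  {f | ∃ g : ℝ → ℝ, MemLp g 2 (volume.restrict (Icc (0 : ℝ) 1)) ∧
    ∀ t : I, f t = fracIntegral α g t}

end BiFBm

/-! A function `f` lies in the RKHS of a covariance `R` exactly when `(∑ a_i f_i)² ≤ C ∑ a_i a_j
R(i,j)` for some `C` and all finite families (`mem_processRKHS_iff`). An inclusion of RKHSs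
therefore follows once one quadratic form is bounded by a multiple of the other
(`processRKHS_subset`).

Put `u(t) = t^{2H}` and let `R` be the covariance of `B^H`, so that `u(s) + u(t) - 2R(s,t) =
|s-t|^{2H}`. Up to the factor `2^{-K}`, the covariance of `Z^{H,K}` is `(u_s+u_t)^K -
(u_s+u_t-2R)^K`. Powers are linearized by `c x^K = ∫₀^∞ (1 - e^{-xθ}) θ^{-1-K} dθ`, with `c > 0`.

For `H(Z) ⊆ H(B^{HK})`, the kernel `u_s^K + u_t^K - (u_s+u_t)^K` is a superposition of the rank-one
kernels `(1-e^{-θu_s})(1-e^{-θu_t})`, hence positive.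

For `H(B^H) ⊆ H(Z)`, the integrand `e^{-θ(u_s+u_t)}(e^{2θR} - 1)` dominates `θ e^{-Mθ} R` for every
`θ` (`quadForm_le_exp`), provided `u` itself lies in `H(B^H)` with constant `M`. Integrating in `θ`
gives a finite positive multiple of `R`.

The Mandelbrot–Van Ness representation turns the form of `R` into an `L²` norm. Then `u ∈ H(B^H)` is
Cauchy–Schwarz plus a beta integral, and `I^{3/2}(L²) ⊆ H(B^H)` comes from `I^{3/2} = I^{H+1/2}
I^{1-H}` and Young's inequality. -/

namespace BiFBm

/-! ### Quadratic forms of kernels -/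

/-- The quadratic form `∑ a_i a_j k(i,j)` of a real kernel, over a finite set of points. -/
def quadForm {T : Type*} (s : Finset T) (a : T → ℝ) (k : T → T → ℝ) : ℝ :=
  ∑ i ∈ s, ∑ j ∈ s, a i * a j * k i j

section quadForm

variable {T : Type*} (s : Finset T) (a : T → ℝ) (k l : T → T → ℝ)

theorem quadForm_add : quadForm s a (fun i j ↦ k i j + l i j) = quadForm s a k + quadForm s a l := by
  simp only [quadForm, mul_add, Finset.sum_add_distrib]

theorem quadForm_sub : quadForm s a (fun i j ↦ k i j - l i j) = quadForm s a k - quadForm s a l := by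
  simp only [quadForm, mul_sub, Finset.sum_sub_distrib]

theorem quadForm_const_mul (c : ℝ) : quadForm s a (fun i j ↦ c * k i j) = c * quadForm s a k := by
  simp only [quadForm, Finset.mul_sum]
  exact Finset.sum_congr rfl fun i _ ↦ Finset.sum_congr rfl fun j _ ↦ by ring

theorem quadForm_mul (f g : T → ℝ) :
    quadForm s a (fun i j ↦ f i * g j) = (∑ i ∈ s, a i * f i) * ∑ i ∈ s, a i * g i := by
  rw [quadForm, Finset.sum_mul_sum]
  exact Finset.sum_congr rfl fun i _ ↦ Finset.sum_congr rfl fun j _ ↦ by ring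

theorem quadForm_mul_self (g : T → ℝ) :
    quadForm s a (fun i j ↦ g i * g j) = (∑ i ∈ s, a i * g i) ^ 2 := by
  rw [quadForm_mul, sq]

theorem integrable_quadForm {α : Type*} {mα : MeasurableSpace α} {μ : Measure α}
    {κ : α → T → T → ℝ} (hκ : ∀ i j, Integrable (fun x ↦ κ x i j) μ) :
    Integrable (fun x ↦ quadForm s a (κ x)) μ :=
  integrable_finsetSum _ fun i _ ↦ integrable_finsetSum _ fun j _ ↦ (hκ i j).const_mul _

theorem quadForm_integral {α : Type*} {mα : MeasurableSpace α} {μ : Measure α}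
    {κ : α → T → T → ℝ} (hκ : ∀ i j, Integrable (fun x ↦ κ x i j) μ) :
    quadForm s a (fun i j ↦ ∫ x, κ x i j ∂μ) = ∫ x, quadForm s a (κ x) ∂μ := by
  simp only [quadForm]
  rw [integral_finsetSum _ fun i _ ↦ integrable_finsetSum _ fun j _ ↦ (hκ i j).const_mul _]
  refine Finset.sum_congr rfl fun i _ ↦ ?_
  rw [integral_finsetSum _ fun j _ ↦ (hκ i j).const_mul _]
  exact Finset.sum_congr rfl fun j _ ↦ by rw [integral_const_mul]

end quadForm

/-! ### Positive kernels and their closure properties -/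

/-- A symmetric positive semidefinite real kernel. -/
structure IsPosKernel {T : Type*} (k : T → T → ℝ) : Prop where
  symm : ∀ i j, k i j = k j i
  nonneg : ∀ s a, 0 ≤ quadForm s a k

theorem hasSum_real_exp (x : ℝ) : HasSum (fun n : ℕ ↦ x ^ n / n.factorial) (Real.exp x) := by
  rw [Real.exp_eq_exp_ℝ]
  exact NormedSpace.expSeries_div_hasSum_exp x

namespace IsPosKernel

variable {T : Type*} {k l : T → T → ℝ}

theorem of_posSemidef (h : (Matrix.of k).PosSemidef) : IsPosKernel k where
  symm i j := by simpa using (h.isHermitian.apply j i)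
  nonneg s a := by
    have := (h.submatrix ((↑) : s → T)).dotProduct_mulVec_nonneg (fun i ↦ a i)
    simp only [dotProduct, Matrix.mulVec, Finset.mul_sum] at this
    rw [quadForm, ← Finset.sum_coe_sort]
    simp_rw [← Finset.sum_coe_sort s]
    refine this.trans_eq (Finset.sum_congr rfl fun i _ ↦ Finset.sum_congr rfl fun j _ ↦ ?_)
    simp
    ring

theorem posSemidef (h : IsPosKernel k) : (Matrix.of k).PosSemidef := by
  refine ⟨?_, fun x ↦ ?_⟩
  · ext i j
    simp [h.symm i j]
  · refine (h.nonneg x.support x).trans_eq ?_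
    simp only [quadForm, Finsupp.sum, Matrix.of_apply, star_trivial]
    exact Finset.sum_congr rfl fun i _ ↦ Finset.sum_congr rfl fun j _ ↦ by ring

/-- The Schur product theorem; the passage to `Matrix.PosSemidef` serves only to invoke it. -/
theorem mul (hk : IsPosKernel k) (hl : IsPosKernel l) : IsPosKernel fun i j ↦ k i j * l i j :=
  of_posSemidef (hk.posSemidef.hadamard hl.posSemidef)

theorem add (hk : IsPosKernel k) (hl : IsPosKernel l) : IsPosKernel fun i j ↦ k i j + l i j where
  symm i j := by rw [hk.symm, hl.symm]
  nonneg s a := by rw [quadForm_add]; exact add_nonneg (hk.nonneg s a) (hl.nonneg s a)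

theorem const_mul {c : ℝ} (hc : 0 ≤ c) (hk : IsPosKernel k) : IsPosKernel fun i j ↦ c * k i j where
  symm i j := by rw [hk.symm]
  nonneg s a := by rw [quadForm_const_mul]; exact mul_nonneg hc (hk.nonneg s a)

theorem mul_self (g : T → ℝ) : IsPosKernel fun i j ↦ g i * g j where
  symm i j := mul_comm _ _
  nonneg s a := by rw [quadForm_mul_self]; positivity

theorem one : IsPosKernel fun _ _ : T ↦ (1 : ℝ) := by
  simpa using mul_self (fun _ : T ↦ (1 : ℝ))

theorem pow (hk : IsPosKernel k) (n : ℕ) : IsPosKernel fun i j ↦ k i j ^ n := by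
  induction n with
  | zero => simpa using one
  | succ n ih => simpa only [pow_succ] using ih.mul hk

/-- A power series with nonnegative coefficients maps positive kernels to positive kernels. -/
theorem of_hasSum (hk : IsPosKernel k) {c : ℕ → ℝ} (hc : ∀ n, 0 ≤ c n) {F : ℝ → ℝ}
    (hF : ∀ x, HasSum (fun n ↦ c n * x ^ n) (F x)) : IsPosKernel fun i j ↦ F (k i j) where
  symm i j := by rw [hk.symm]
  nonneg s a := by
    have : HasSum (fun n ↦ quadForm s a fun i j ↦ c n * k i j ^ n)
        (quadForm s a fun i j ↦ F (k i j)) :=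
      hasSum_sum fun i _ ↦ hasSum_sum fun j _ ↦ (hF (k i j)).mul_left _
    exact this.nonneg fun n ↦ ((hk.pow n).const_mul (hc n)).nonneg s a

theorem exp_sub_one (hk : IsPosKernel k) : IsPosKernel fun i j ↦ Real.exp (k i j) - 1 := by
  -- Subtracting 1 removes exactly the constant term of the exponential series.
  refine hk.of_hasSum (c := fun n ↦ if n = 0 then 0 else (n.factorial : ℝ)⁻¹)
    (F := fun x ↦ Real.exp x - 1) (fun n ↦ by positivity) fun x ↦ ?_
  have h := (hasSum_real_exp x).sub (hasSum_ite_eq 0 (1 : ℝ))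
  refine h.congr_fun fun n ↦ ?_
  rcases eq_or_ne n 0 with rfl | hn
  · simp
  · simp [hn, div_eq_inv_mul]

/-- The kernel `e^{2k} - 1 - k e^k` is positive, since its power series is
`∑ (2^n - n) k^n / n!`, `n ≥ 1`. -/
theorem exp_two_mul_sub (hk : IsPosKernel k) :
    IsPosKernel fun i j ↦ Real.exp (2 * k i j) - 1 - k i j * Real.exp (k i j) := by
  refine hk.of_hasSum (c := fun n ↦ if n = 0 then 0 else (2 ^ n - n) / (n.factorial : ℝ))
    (F := fun x ↦ Real.exp (2 * x) - 1 - x * Real.exp x) (fun n ↦ ?_) fun x ↦ ?_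
  · have : (n : ℝ) ≤ 2 ^ n := by exact_mod_cast n.lt_two_pow_self.le
    split_ifs
    · rfl
    · exact div_nonneg (sub_nonneg.2 this) (by positivity)
  · have h1 := (hasSum_real_exp (2 * x)).sub (hasSum_ite_eq 0 (1 : ℝ))
    have h2 : HasSum (fun n : ℕ ↦ (n : ℝ) * x ^ n / n.factorial) (x * Real.exp x) := by
      rw [← hasSum_nat_add_iff' 1]
      simp only [Finset.sum_range_one, Nat.cast_zero, zero_mul, zero_div, sub_zero]
      refine ((hasSum_real_exp x).mul_left x).congr_fun fun n ↦ ?_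
      rw [Nat.factorial_succ, pow_succ]
      push_cast
      field_simp
    refine (h1.sub h2).congr_fun fun n ↦ ?_
    rcases eq_or_ne n 0 with rfl | hn
    · simp
    · simp [hn, mul_pow]
      ring

end IsPosKernel

/-! ### RKHS membership as a domination of quadratic forms -/

/-- `f` is dominated by the kernel `k` with constant `C`: `(∑ a_i f_i)² ≤ C ∑ a_i a_j k(i,j)`. For a
positive kernel this says that `f` lies in the reproducing kernel Hilbert space of `k`. -/
def KernelBound {T : Type*} (k : T → T → ℝ) (f : T → ℝ) (C : ℝ) : Prop :=
  ∀ (s : Finset T) (a : T → ℝ), (∑ i ∈ s, a i * f i) ^ 2 ≤ C * quadForm s a k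

theorem KernelBound.mono {T : Type*} {k l : T → T → ℝ} {f : T → ℝ} {C D : ℝ}
    (h : KernelBound k f C) (hC : 0 ≤ C) (hkl : ∀ s a, quadForm s a k ≤ D * quadForm s a l) :
    KernelBound l f (C * D) := fun s a ↦
  (h s a).trans (by rw [mul_assoc]; exact mul_le_mul_of_nonneg_left (hkl s a) hC)

theorem real_inner_sum_smul {T V : Type*} [NormedAddCommGroup V] [InnerProductSpace ℝ V]
    (s : Finset T) (a : T → ℝ) (v : T → V) (w : V) :
    inner ℝ w (∑ i ∈ s, a i • v i) = ∑ i ∈ s, a i * inner ℝ w (v i) := by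
  simp [inner_sum, inner_smul_right]

theorem norm_sq_sum_smul {T V : Type*} [NormedAddCommGroup V] [InnerProductSpace ℝ V]
    (s : Finset T) (a : T → ℝ) (v : T → V) :
    ‖∑ i ∈ s, a i • v i‖ ^ 2 = quadForm s a fun i j ↦ inner ℝ (v i) (v j) := by
  rw [← real_inner_self_eq_norm_sq, sum_inner, quadForm]
  refine Finset.sum_congr rfl fun i _ ↦ ?_
  rw [real_inner_smul_left, real_inner_sum_smul, Finset.mul_sum]
  exact Finset.sum_congr rfl fun j _ ↦ by ring

-- One direction is the reproducing property and Cauchy–Schwarz, with `C = ‖g‖²`. Conversely, the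
-- bound says that `∑ a_i R(i,·) ↦ ∑ a_i f_i` is well defined and bounded on a dense subspace; the
-- Riesz representative of its extension takes the values of `f`.
open RKHS in
theorem mem_processRKHS_iff {T Ω : Type*} {mΩ : MeasurableSpace Ω} {X : T → Ω → ℝ} {P : Measure Ω}
    (hX : IsGaussianProcess X P) {f : T → ℝ} :
    f ∈ processRKHS hX ↔ ∃ C, 0 ≤ C ∧ KernelBound (covFun X P) f C := by
  classical
  have : Fact (covMatrix X P).PosSemidef := ⟨covMatrix_posSemidef (memLp_two hX)⟩
  let E := OfKernel (covMatrix X P)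
  have hker : ∀ i j, inner ℝ (kerFun E i (1 : ℝ)) (kerFun E j (1 : ℝ)) = covFun X P j i := by
    intro i j
    rw [← kernel_inner E j i, OfKernel.kernel_ofKernel]
    simp [covMatrix]
  have hsymm : ∀ i j, covFun X P i j = covFun X P j i := fun i j ↦ by simp [covFun, mul_comm]
  have hnorm : ∀ (s : Finset T) (a : T → ℝ),
      ‖∑ i ∈ s, a i • kerFun E i (1 : ℝ)‖ ^ 2 = quadForm s a (covFun X P) := by
    intro s a
    rw [norm_sq_sum_smul]
    exact congrArg _ (funext fun i ↦ funext fun j ↦ by rw [hker, hsymm])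
  constructor
  · rintro ⟨g, rfl⟩
    refine ⟨‖(g : E)‖ ^ 2, by positivity, fun s a ↦ ?_⟩
    have : ∑ i ∈ s, a i * (g : E) i = inner ℝ (g : E) (∑ i ∈ s, a i • kerFun E i (1 : ℝ)) := by
      rw [real_inner_sum_smul]
      refine Finset.sum_congr rfl fun i _ ↦ ?_
      rw [inner_kerFun]
      simp
    rw [← hnorm, this, ← mul_pow, sq_le_sq, abs_of_nonneg (a := ‖(g : E)‖ * _) (by positivity)]
    exact abs_real_inner_le_norm _ _
  · rintro ⟨C, hC, hf⟩
    let e : (T →₀ ℝ) →ₗ[ℝ] E := Finsupp.linearCombination ℝ fun i ↦ kerFun E i (1 : ℝ)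
    let φ : (T →₀ ℝ) →ₗ[ℝ] ℝ := Finsupp.linearCombination ℝ f
    have hdense : DenseRange e := by
      have h := kerFun_dense (𝕜 := ℝ) E
      rw [← Submodule.dense_iff_topologicalClosure_eq_top] at h
      refine h.mono ?_
      rw [← LinearMap.coe_range, SetLike.coe_subset_coe, Submodule.span_le]
      rintro _ ⟨x, v, rfl⟩
      refine ⟨Finsupp.single x v, ?_⟩
      simp only [e, Finsupp.linearCombination_single, ← map_smul]
      simp
    have hbound : ∀ x, ‖φ x‖ ≤ √C * ‖e x‖ := by
      intro x
      rw [Real.norm_eq_abs, ← abs_of_nonneg (a := √C * ‖e x‖) (by positivity), ← sq_le_sq, mul_pow,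
        Real.sq_sqrt hC]
      have he : ‖e x‖ ^ 2 = quadForm x.support x (covFun X P) := hnorm x.support x
      rw [he]
      exact hf x.support x
    let L : E →L[ℝ] ℝ := φ.extendOfNorm e
    refine ⟨((InnerProductSpace.toDual ℝ E).symm L : E), funext fun t ↦ ?_⟩
    have h1 : inner ℝ ((InnerProductSpace.toDual ℝ E).symm L : E) (kerFun E t (1 : ℝ)) = f t := by
      rw [InnerProductSpace.toDual_symm_apply]
      have := LinearMap.extendOfNorm_eq hdense ⟨_, hbound⟩ (Finsupp.single t 1)
      simpa [e, φ] using this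
    rw [inner_kerFun] at h1
    simpa using h1

theorem processRKHS_subset {T Ω Ω' : Type*} {mΩ : MeasurableSpace Ω} {mΩ' : MeasurableSpace Ω'}
    {X : T → Ω → ℝ} {Y : T → Ω' → ℝ} {P : Measure Ω} {Q : Measure Ω'}
    (hX : IsGaussianProcess X P) (hY : IsGaussianProcess Y Q) {C : ℝ} (hC : 0 ≤ C)
    (h : ∀ s a, quadForm s a (covFun X P) ≤ C * quadForm s a (covFun Y Q)) :
    processRKHS hX ⊆ processRKHS hY := by
  intro f hf
  rw [mem_processRKHS_iff] at hf ⊢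
  obtain ⟨D, hD, hf⟩ := hf
  exact ⟨D * C, by positivity, hf.mono hD h⟩

/-! ### Pointwise comparison with exponential kernels -/

/-- With `q`, `m`, `b` the values of `∑∑ a_i a_j R`, `∑ a_i u_i`, `∑ a_i`, the form equals `q - 2mb
+ Mb²`, which is nonnegative because `m² ≤ Mq`. -/
theorem IsPosKernel.affine {T : Type*} {R : T → T → ℝ} {u : T → ℝ} {M : ℝ} (hR : IsPosKernel R)
    (hu : KernelBound R u M) (hM : 0 ≤ M) : IsPosKernel fun i j ↦ R i j - u i - u j + M where
  symm i j := by rw [hR.symm]; ring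
  nonneg s a := by
    have key : quadForm s a (fun i j ↦ R i j - u i - u j + M) =
        quadForm s a R - 2 * (∑ i ∈ s, a i * u i) * (∑ i ∈ s, a i) + M * (∑ i ∈ s, a i) ^ 2 := by
      -- The constant function 1 is kept opaque so that the cross terms have the product shape
      -- required by `quadForm_mul`.
      obtain ⟨e, he⟩ : ∃ e : T → ℝ, ∀ i, e i = 1 := ⟨fun _ ↦ 1, fun _ ↦ rfl⟩
      have h : (fun i j ↦ R i j - u i - u j + M) =
          fun i j ↦ R i j - u i * e j - e i * u j + M * (e i * e j) := by simp [he]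
      rw [h, quadForm_add, quadForm_sub, quadForm_sub, quadForm_const_mul _ _ _ M,
        quadForm_mul s a u e, quadForm_mul s a e u, quadForm_mul s a e e]
      simp only [he, mul_one]
      ring
    rw [key]
    have h1 := hu s a
    have h2 := hR.nonneg s a
    generalize quadForm s a R = q at *
    generalize ∑ i ∈ s, a i * u i = m at *
    generalize ∑ i ∈ s, a i = b at *
    -- `4m²b² ≤ 4Mqb² = (q + Mb²)² - (q - Mb²)²`.
    have h3 : (2 * m * b) ^ 2 ≤ (q + M * b ^ 2) ^ 2 := by
      nlinarith [mul_le_mul_of_nonneg_right h1 (sq_nonneg b), sq_nonneg (q - M * b ^ 2)]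
    linarith [abs_le_of_sq_le_sq h3 (by positivity), le_abs_self (2 * m * b)]

/-- The right-hand kernel is `e^{-θu_i} e^{-θu_j} (e^{2θR} - 1)`. Since `e^{2x} - 1 - x e^x`
preserves positivity, it dominates `θR e^{θ(R-u_i-u_j)} = θ e^{-Mθ} R e^{θ(R-u_i-u_j+M)}`. The last
exponent is a positive kernel by `IsPosKernel.affine`, so replacing its exponential by 1 only
decreases the form. -/
theorem quadForm_le_exp {T : Type*} {R : T → T → ℝ} {u : T → ℝ} {M : ℝ} (hR : IsPosKernel R)
    (hu : KernelBound R u M) (hM : 0 ≤ M) {θ : ℝ} (hθ : 0 ≤ θ) (s : Finset T) (a : T → ℝ) :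
    θ * Real.exp (-(M * θ)) * quadForm s a R ≤ quadForm s a fun i j ↦
      Real.exp (-((u i + u j - 2 * R i j) * θ)) - Real.exp (-((u i + u j) * θ)) := by
  have h1 := (IsPosKernel.mul_self fun i ↦ Real.exp (-(u i * θ))).mul
    (hR.const_mul hθ).exp_two_mul_sub
  have h2 := (hR.const_mul (c := θ * Real.exp (-(M * θ))) (by positivity)).mul
    ((hR.affine hu hM).const_mul hθ).exp_sub_one
  have h3 := (h1.add h2).nonneg s a
  rw [← quadForm_const_mul, ← sub_nonneg, ← quadForm_sub]
  refine h3.trans_eq (congrArg _ (funext fun i ↦ funext fun j ↦ ?_))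
  have e1 : Real.exp (-((u i + u j) * θ)) = Real.exp (-(u i * θ)) * Real.exp (-(u j * θ)) := by
    rw [← Real.exp_add]; ring_nf
  have e2 : Real.exp (-((u i + u j - 2 * R i j) * θ)) =
      Real.exp (-(u i * θ)) * Real.exp (-(u j * θ)) * Real.exp (2 * (θ * R i j)) := by
    rw [← Real.exp_add, ← Real.exp_add]; ring_nf
  have e3 : Real.exp (-(M * θ)) * Real.exp (θ * (R i j - u i - u j + M)) =
      Real.exp (-(u i * θ)) * Real.exp (-(u j * θ)) * Real.exp (θ * R i j) := by
    rw [← Real.exp_add, ← Real.exp_add, ← Real.exp_add]; ring_nf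
  rw [e1, e2]
  linear_combination θ * R i j * e3

/-! ### Subordination: powers as mixtures of exponentials -/

/-- The constant `∫₀^∞ (1 - e^{-θ}) θ^{-1-K} dθ`. -/
noncomputable def subordConst (K : ℝ) : ℝ :=
  ∫ θ in Ioi (0 : ℝ), (1 - Real.exp (-θ)) * θ ^ (-1 - K)

section subordination

variable {K : ℝ}

/-- The integrand is at most `θ^{-K}` near 0 (as `1 - e^{-θ} ≤ θ`) and at most `θ^{-1-K}` at
infinity. -/
theorem integrableOn_one_sub_exp (hK : K ∈ Ioo (0 : ℝ) 1) : IntegrableOn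
    (fun θ : ℝ ↦ (1 - Real.exp (-θ)) * θ ^ (-1 - K)) (Ioi 0) := by
  have hc : ContinuousOn (fun θ : ℝ ↦ (1 - Real.exp (-θ)) * θ ^ (-1 - K)) (Ioi 0) := by
    refine ContinuousOn.mul (by fun_prop) ?_
    exact ContinuousOn.rpow_const continuousOn_id fun x hx ↦ Or.inl (ne_of_gt hx)
  rw [← Ioc_union_Ioi_eq_Ioi zero_le_one]
  refine IntegrableOn.union ?_ ?_
  · have h : IntegrableOn (fun θ : ℝ ↦ θ ^ (-K)) (Ioc 0 1) := by
      rw [← intervalIntegrable_iff_integrableOn_Ioc_of_le zero_le_one]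
      exact intervalIntegral.intervalIntegrable_rpow' (by linarith [hK.2])
    refine Integrable.mono' h
      ((hc.mono Ioc_subset_Ioi_self).aestronglyMeasurable measurableSet_Ioc) ?_
    refine (ae_restrict_iff' measurableSet_Ioc).2 (ae_of_all _ fun θ hθ ↦ ?_)
    have h1 : 0 ≤ 1 - Real.exp (-θ) := by simp [hθ.1.le]
    have h2 : 1 - Real.exp (-θ) ≤ θ := by linarith [Real.add_one_le_exp (-θ)]
    have h3 : 0 ≤ θ ^ (-1 - K) := Real.rpow_nonneg hθ.1.le _
    rw [Real.norm_of_nonneg (mul_nonneg h1 h3), show -K = 1 + (-1 - K) by ring,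
      Real.rpow_add hθ.1, Real.rpow_one]
    exact mul_le_mul_of_nonneg_right h2 h3
  · refine Integrable.mono' (integrableOn_Ioi_rpow_of_lt (a := -1 - K) (by linarith [hK.1]) one_pos)
      ((hc.mono (Ioi_subset_Ioi zero_le_one)).aestronglyMeasurable measurableSet_Ioi) ?_
    refine (ae_restrict_iff' measurableSet_Ioi).2 (ae_of_all _ fun θ hθ ↦ ?_)
    have hθ0 : 0 < θ := one_pos.trans hθ
    have h1 : 0 ≤ 1 - Real.exp (-θ) := by simp [hθ0.le]
    have h3 : 0 ≤ θ ^ (-1 - K) := Real.rpow_nonneg hθ0.le _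
    rw [Real.norm_of_nonneg (mul_nonneg h1 h3)]
    exact mul_le_of_le_one_left h3 (by linarith [Real.exp_pos (-θ)])

theorem subordConst_pos (hK : K ∈ Ioo (0 : ℝ) 1) : 0 < subordConst K := by
  refine (setIntegral_pos_iff_support_of_nonneg_ae ?_ (integrableOn_one_sub_exp hK)).2 ?_
  · refine (ae_restrict_iff' measurableSet_Ioi).2 (ae_of_all _ fun θ (hθ : 0 < θ) ↦ ?_)
    exact mul_nonneg (by simp [hθ.le]) (Real.rpow_nonneg hθ.le _)
  · have : Ioi (0 : ℝ) ⊆ Function.support fun θ : ℝ ↦ (1 - Real.exp (-θ)) * θ ^ (-1 - K) := by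
      intro θ (hθ : 0 < θ)
      have : Real.exp (-θ) < 1 := by simpa using hθ
      exact (mul_pos (by linarith) (Real.rpow_pos_of_pos hθ _)).ne'
    rw [inter_eq_right.2 this]
    simp

theorem one_sub_exp_comp_mul {a θ : ℝ} (ha : 0 < a) (hθ : 0 < θ) :
    (1 - Real.exp (-(a * θ))) * θ ^ (-1 - K) =
      a ^ (1 + K) * ((1 - Real.exp (-(a * θ))) * (a * θ) ^ (-1 - K)) := by
  rw [Real.mul_rpow ha.le hθ.le, show (-1 - K) = -(1 + K) by ring, Real.rpow_neg ha.le]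
  have := (Real.rpow_pos_of_pos ha (1 + K)).ne'
  field_simp

theorem integrableOn_one_sub_exp_mul (hK : K ∈ Ioo (0 : ℝ) 1) {a : ℝ} (ha : 0 ≤ a) : IntegrableOn
    (fun θ : ℝ ↦ (1 - Real.exp (-(a * θ))) * θ ^ (-1 - K)) (Ioi 0) := by
  rcases ha.eq_or_lt with rfl | ha
  · simp
  have h := (integrableOn_Ioi_comp_mul_left_iff
    (fun θ : ℝ ↦ (1 - Real.exp (-θ)) * θ ^ (-1 - K)) 0 ha).2
    (by simpa using integrableOn_one_sub_exp hK)
  exact IntegrableOn.congr_fun (h.const_mul (a ^ (1 + K)))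
    (fun θ hθ ↦ (one_sub_exp_comp_mul ha hθ).symm) measurableSet_Ioi

theorem integral_one_sub_exp_mul (hK : K ∈ Ioo (0 : ℝ) 1) {a : ℝ} (ha : 0 ≤ a) :
    ∫ θ in Ioi (0 : ℝ), (1 - Real.exp (-(a * θ))) * θ ^ (-1 - K) = subordConst K * a ^ K := by
  rcases ha.eq_or_lt with rfl | ha
  · simp [Real.zero_rpow hK.1.ne']
  rw [setIntegral_congr_fun measurableSet_Ioi fun θ hθ ↦ one_sub_exp_comp_mul ha hθ,
    integral_const_mul, integral_comp_mul_left_Ioi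
      (fun θ : ℝ ↦ (1 - Real.exp (-θ)) * θ ^ (-1 - K)) 0 ha, mul_zero, smul_eq_mul,
    ← mul_assoc, Real.rpow_add ha, Real.rpow_one, subordConst]
  field_simp

/-- If `(u_i + u_j - 2 R(i,j))` is the variogram of the kernel `R` and the diagonal `u` lies in the
reproducing kernel Hilbert space of `R`, then `R` is dominated by
`(u_i + u_j)^K - (u_i + u_j - 2 R(i,j))^K`. -/
theorem exists_quadForm_le_rpow_sub (hK : K ∈ Ioo (0 : ℝ) 1) {T : Type*} {R : T → T → ℝ} {u : T → ℝ} {M : ℝ}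
    (hR : IsPosKernel R) (hu : KernelBound R u M) (hM : 0 < M) (hu0 : ∀ i, 0 ≤ u i)
    (hd : ∀ i j, 0 ≤ u i + u j - 2 * R i j) :
    ∃ C, 0 ≤ C ∧ ∀ s a, quadForm s a R ≤ C * quadForm s a fun i j ↦
      (u i + u j) ^ K - (u i + u j - 2 * R i j) ^ K := by
  -- This is the total weight `∫ θ e^{-Mθ} θ^{-1-K} dθ` that `R` receives; the exponent is written
  -- `1 - K - 1` to match the Gamma integral.
  have hI : 0 < ∫ θ in Ioi (0 : ℝ), θ ^ (1 - K - 1) * Real.exp (-(M * θ)) := by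
    rw [Real.integral_rpow_mul_exp_neg_mul_Ioi (by linarith [hK.2]) hM]
    have := Real.Gamma_pos_of_pos (s := 1 - K) (by linarith [hK.2])
    positivity
  -- A non-integrable function has integral 0 by convention, so positivity of the integral gives
  -- integrability.
  have hint : IntegrableOn (fun θ : ℝ ↦ θ ^ (1 - K - 1) * Real.exp (-(M * θ))) (Ioi 0) := by
    by_contra h
    exact hI.ne' (integral_undef h)
  set I₀ := ∫ θ in Ioi (0 : ℝ), θ ^ (1 - K - 1) * Real.exp (-(M * θ))
  have hc := subordConst_pos hK
  refine ⟨subordConst K / I₀, by positivity, fun s a ↦ ?_⟩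
  let κ : ℝ → T → T → ℝ := fun θ i j ↦ θ ^ (-1 - K) *
    (Real.exp (-((u i + u j - 2 * R i j) * θ)) - Real.exp (-((u i + u j) * θ)))
  have hsub : ∀ i j, (fun θ ↦ κ θ i j) = fun θ ↦
      (1 - Real.exp (-((u i + u j) * θ))) * θ ^ (-1 - K) -
      (1 - Real.exp (-((u i + u j - 2 * R i j) * θ))) * θ ^ (-1 - K) :=
    fun i j ↦ funext fun θ ↦ by simp only [κ]; ring
  have hi1 : ∀ i j, IntegrableOn
      (fun θ : ℝ ↦ (1 - Real.exp (-((u i + u j) * θ))) * θ ^ (-1 - K)) (Ioi 0) :=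
    fun i j ↦ integrableOn_one_sub_exp_mul hK (add_nonneg (hu0 i) (hu0 j))
  have hi2 : ∀ i j, IntegrableOn
      (fun θ : ℝ ↦ (1 - Real.exp (-((u i + u j - 2 * R i j) * θ))) * θ ^ (-1 - K)) (Ioi 0) :=
    fun i j ↦ integrableOn_one_sub_exp_mul hK (hd i j)
  have hκ : ∀ i j, Integrable (fun θ ↦ κ θ i j) (volume.restrict (Ioi 0)) := fun i j ↦ by
    rw [hsub]
    exact (hi1 i j).sub (hi2 i j)
  have hval : ∀ i j, ∫ θ in Ioi 0, κ θ i j =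
      subordConst K * ((u i + u j) ^ K - (u i + u j - 2 * R i j) ^ K) := fun i j ↦ by
    rw [hsub, integral_sub (hi1 i j) (hi2 i j),
      integral_one_sub_exp_mul hK (add_nonneg (hu0 i) (hu0 j)),
      integral_one_sub_exp_mul hK (hd i j)]
    ring
  have key : I₀ * quadForm s a R ≤ subordConst K * quadForm s a fun i j ↦
      (u i + u j) ^ K - (u i + u j - 2 * R i j) ^ K := by
    rw [← quadForm_const_mul s a _ (subordConst K)]
    simp_rw [← hval]
    rw [quadForm_integral s a hκ, ← integral_mul_const]
    refine setIntegral_mono_on (hint.mul_const _) (integrable_quadForm s a hκ) measurableSet_Ioi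
      fun θ (hθ : 0 < θ) ↦ ?_
    simp only [κ]
    rw [quadForm_const_mul, show 1 - K - 1 = 1 + (-1 - K) by ring, Real.rpow_add hθ, Real.rpow_one]
    have := mul_le_mul_of_nonneg_left (quadForm_le_exp hR hu hM.le hθ.le s a)
      (Real.rpow_nonneg hθ.le (-1 - K))
    refine le_trans (le_of_eq ?_) this
    ring
  rw [div_mul_eq_mul_div, le_div_iff₀ hI, mul_comm]
  exact key

/-- By `(1-x) + (1-y) - (1-xy) = (1-x)(1-y)` with `x = e^{-θu_i}`, `y = e^{-θu_j}`, the kernel is a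
positive mixture of rank-one kernels. -/
theorem isPosKernel_rpow_add_sub (hK : K ∈ Ioo (0 : ℝ) 1) {T : Type*} {u : T → ℝ} (hu0 : ∀ i, 0 ≤ u i) :
    IsPosKernel fun i j ↦ u i ^ K + u j ^ K - (u i + u j) ^ K where
  symm i j := by rw [add_comm (u i), add_comm (u i ^ K)]
  nonneg s a := by
    let κ : ℝ → T → T → ℝ := fun θ i j ↦ θ ^ (-1 - K) *
      ((1 - Real.exp (-(u i * θ))) * (1 - Real.exp (-(u j * θ))))
    have hi : ∀ a : ℝ, 0 ≤ a → IntegrableOn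
      (fun θ : ℝ ↦ (1 - Real.exp (-(a * θ))) * θ ^ (-1 - K)) (Ioi 0) :=
      fun a ↦ integrableOn_one_sub_exp_mul hK
    have hsub : ∀ i j, (fun θ ↦ κ θ i j) = fun θ ↦
        (1 - Real.exp (-(u i * θ))) * θ ^ (-1 - K) + (1 - Real.exp (-(u j * θ))) * θ ^ (-1 - K)
          - (1 - Real.exp (-((u i + u j) * θ))) * θ ^ (-1 - K) := fun i j ↦ funext fun θ ↦ by
      simp only [κ, add_mul, neg_add, Real.exp_add]
      ring
    have hij : ∀ i j, 0 ≤ u i + u j := fun i j ↦ add_nonneg (hu0 i) (hu0 j)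
    have hκ : ∀ i j, Integrable (fun θ ↦ κ θ i j) (volume.restrict (Ioi 0)) := fun i j ↦ by
      rw [hsub]
      exact ((hi _ (hu0 i)).add (hi _ (hu0 j))).sub (hi _ (hij i j))
    have hval : ∀ i j, ∫ θ in Ioi 0, κ θ i j =
        subordConst K * (u i ^ K + u j ^ K - (u i + u j) ^ K) := fun i j ↦ by
      have h := (hi _ (hu0 i)).add (hi _ (hu0 j))
      rw [hsub]
      refine (integral_sub h (hi _ (hij i j))).trans ?_
      simp only [Pi.add_apply]
      rw [integral_add (hi _ (hu0 i)) (hi _ (hu0 j)), integral_one_sub_exp_mul hK (hu0 i),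
        integral_one_sub_exp_mul hK (hu0 j), integral_one_sub_exp_mul hK (hij i j)]
      ring
    refine nonneg_of_mul_nonneg_right (a := subordConst K) ?_ (subordConst_pos hK)
    rw [← quadForm_const_mul]
    simp_rw [← hval]
    rw [quadForm_integral s a hκ]
    refine setIntegral_nonneg measurableSet_Ioi fun θ (hθ : 0 < θ) ↦ ?_
    exact ((IsPosKernel.mul_self fun i ↦ 1 - Real.exp (-(u i * θ))).const_mul
      (Real.rpow_nonneg hθ.le _)).nonneg s a

end subordination

/-! ### The Mandelbrot–Van Ness representation -/

/-- The function `x ↦ x_+^p`. -/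
noncomputable def posPow (p x : ℝ) : ℝ := if 0 < x then x ^ p else 0

theorem posPow_of_pos {p x : ℝ} (hx : 0 < x) : posPow p x = x ^ p := if_pos hx

theorem posPow_of_nonpos {p x : ℝ} (hx : x ≤ 0) : posPow p x = 0 := if_neg hx.not_gt

theorem posPow_nonneg (p x : ℝ) : 0 ≤ posPow p x := by
  rw [posPow]
  split_ifs with h
  · exact Real.rpow_nonneg h.le _
  · rfl

theorem posPow_sq (p x : ℝ) : posPow p x ^ 2 = posPow (2 * p) x := by
  rcases lt_or_ge 0 x with hx | hx
  · rw [posPow_of_pos hx, posPow_of_pos hx, mul_comm, Real.rpow_mul hx.le]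
    norm_cast
  · simp [posPow_of_nonpos hx]

theorem posPow_mul {p t : ℝ} (ht : 0 < t) (x : ℝ) : posPow p (t * x) = t ^ p * posPow p x := by
  rcases lt_or_ge 0 x with hx | hx
  · rw [posPow_of_pos hx, posPow_of_pos (mul_pos ht hx), Real.mul_rpow ht.le hx.le]
  · rw [posPow_of_nonpos hx, posPow_of_nonpos (mul_nonpos_of_nonneg_of_nonpos ht.le hx), mul_zero]

@[fun_prop]
theorem measurable_posPow (p : ℝ) : Measurable (posPow p) :=
  Measurable.ite measurableSet_Ioi (measurable_id.pow_const p) measurable_const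

theorem integrableOn_posPow {p : ℝ} (hp : -1 < p) (a b : ℝ) : IntegrableOn (posPow p) (Ioc a b) := by
  have h1 : IntegrableOn (posPow p) (Ioc 0 (max b 0)) := by
    have h : IntegrableOn (fun x : ℝ ↦ x ^ p) (Ioc 0 (max b 0)) := by
      rw [← intervalIntegrable_iff_integrableOn_Ioc_of_le (le_max_right b 0)]
      exact intervalIntegral.intervalIntegrable_rpow' hp
    exact h.congr_fun (fun x hx ↦ (posPow_of_pos hx.1).symm) measurableSet_Ioc
  have h2 : IntegrableOn (posPow p) (Iic 0) :=
    integrableOn_zero.congr_fun (fun x hx ↦ (posPow_of_nonpos hx).symm) measurableSet_Iic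
  refine (h2.union h1).mono_set fun x hx ↦ ?_
  rcases le_or_gt x 0 with h | h
  · exact Or.inl h
  · exact Or.inr ⟨h, hx.2.trans (le_max_left _ _)⟩

theorem intervalIntegrable_posPow {p : ℝ} (hp : -1 < p) (a b : ℝ) :
    IntervalIntegrable (posPow p) volume a b :=
  ⟨integrableOn_posPow hp a b, integrableOn_posPow hp b a⟩

theorem abs_rpow_one_add_sub_le {p x : ℝ} (hp : |p| ≤ 1) (hx : 0 < x) :
    |(1 + x) ^ p - x ^ p| ≤ x ^ (p - 1) := by
  have h := (convex_Icc x (1 + x)).norm_image_sub_le_of_norm_hasDerivWithin_le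
    (f := fun y : ℝ ↦ y ^ p) (f' := fun y ↦ p * y ^ (p - 1)) (C := x ^ (p - 1))
    (fun y hy ↦ (Real.hasDerivAt_rpow_const
      (Or.inl (hx.trans_le hy.1).ne')).hasDerivWithinAt) (fun y hy ↦ ?_)
    (left_mem_Icc.2 (by linarith)) (right_mem_Icc.2 (by linarith))
  · simpa using h
  · have hy0 := hx.trans_le hy.1
    rw [norm_mul, Real.norm_of_nonneg (Real.rpow_nonneg hy0.le _), Real.norm_eq_abs]
    refine (mul_le_of_le_one_left (Real.rpow_nonneg hy0.le _) hp).trans ?_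
    exact Real.rpow_le_rpow_of_nonpos hx hy.1 (by linarith [(abs_le.1 hp).2])

/-- The Mandelbrot–Van Ness kernel `(t - r)_+^p - (-r)_+^p`. -/
noncomputable def mvnKernel (p t r : ℝ) : ℝ := posPow p (t - r) - posPow p (-r)

@[fun_prop]
theorem measurable_mvnKernel (p t : ℝ) : Measurable (mvnKernel p t) := by
  unfold mvnKernel
  fun_prop

theorem mvnKernel_zero (p : ℝ) : mvnKernel p 0 = 0 := by
  ext r
  simp [mvnKernel]

theorem mvnKernel_sub (p s t r : ℝ) :
    mvnKernel p t r - mvnKernel p s r = mvnKernel p (t - s) (r - s) := by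
  simp only [mvnKernel]
  rw [show t - s - (r - s) = t - r by ring, show -(r - s) = s - r by ring]
  ring

theorem mvnKernel_mul {p t : ℝ} (ht : 0 < t) (r : ℝ) :
    mvnKernel p t (t * r) = t ^ p * mvnKernel p 1 r := by
  simp only [mvnKernel]
  rw [mul_sub, ← posPow_mul ht, ← posPow_mul ht]
  ring_nf

theorem mvnKernel_of_pos {p t r : ℝ} (hr : 0 < r) : mvnKernel p t r = posPow p (t - r) := by
  rw [mvnKernel, posPow_of_nonpos (x := -r) (by linarith), sub_zero]

/-- The singularities are of order `2p > -1`, and at `-∞` the difference decays with exponent `p -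
1`, whose double is below `-1` because `p < 1/2`. -/
theorem integrable_mvnKernel_one_sq {p : ℝ} (hp : p ∈ Ioo (-(1 / 2) : ℝ) (1 / 2)) :
    Integrable fun r ↦ mvnKernel p 1 r ^ 2 := by
  have hp1 : |p| ≤ 1 := abs_le.2 ⟨by linarith [hp.1], by linarith [hp.2]⟩
  have hp2 : -1 < 2 * p := by linarith [hp.1]
  suffices h : Integrable fun x ↦ mvnKernel p 1 (-x) ^ 2 by simpa using h.comp_neg
  rw [← integrableOn_univ]
  have hm : Measurable fun x ↦ mvnKernel p 1 (-x) ^ 2 := by fun_prop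
  have h1 : IntegrableOn (fun x ↦ mvnKernel p 1 (-x) ^ 2) (Iic (-1)) := by
    refine integrableOn_zero.congr_fun (fun x (hx : x ≤ -1) ↦ ?_) measurableSet_Iic
    simp [mvnKernel, posPow_of_nonpos (x := 1 + x) (by linarith),
      posPow_of_nonpos (x := x) (by linarith)]
  have h2 : IntegrableOn (fun x ↦ mvnKernel p 1 (-x) ^ 2) (Ioc (-1) 1) := by
    have hi1 : IntegrableOn (fun x ↦ posPow (2 * p) (1 + x)) (Ioc (-1) 1) := by
      rw [← intervalIntegrable_iff_integrableOn_Ioc_of_le (by norm_num)]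
      simpa using (intervalIntegrable_posPow hp2 0 (1 + 1)).comp_add_left 1
    refine Integrable.mono' ((hi1.const_mul 2).add ((integrableOn_posPow hp2 (-1) 1).const_mul 2))
      hm.aestronglyMeasurable (ae_of_all _ fun x ↦ ?_)
    simp only [mvnKernel, Pi.add_apply, neg_neg, sub_neg_eq_add]
    rw [Real.norm_of_nonneg (sq_nonneg _), ← posPow_sq, ← posPow_sq]
    nlinarith [sq_nonneg (posPow p (1 + x) + posPow p x)]
  have h3 : IntegrableOn (fun x ↦ mvnKernel p 1 (-x) ^ 2) (Ioi 1) := by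
    refine Integrable.mono' (integrableOn_Ioi_rpow_of_lt (a := (p - 1) * 2)
      (by linarith [hp.2]) one_pos) hm.aestronglyMeasurable ?_
    refine (ae_restrict_iff' measurableSet_Ioi).2 (ae_of_all _ fun x hx ↦ ?_)
    have hx0 : 0 < x := one_pos.trans hx
    simp only [mvnKernel, neg_neg, sub_neg_eq_add]
    rw [posPow_of_pos hx0, posPow_of_pos (by linarith), Real.norm_of_nonneg (sq_nonneg _),
      Real.rpow_mul hx0.le, ← sq_abs]
    norm_cast
    exact pow_le_pow_left₀ (abs_nonneg _) (abs_rpow_one_add_sub_le hp1 hx0) 2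
  refine ((h1.union h2).union h3).mono_set fun x _ ↦ ?_
  simp only [mem_union, mem_Iic, mem_Ioc, mem_Ioi]
  grind

/-- The normalizing constant of the Mandelbrot–Van Ness kernel. -/
noncomputable def mvnConst (p : ℝ) : ℝ := ∫ r, mvnKernel p 1 r ^ 2

theorem mvnConst_pos {p : ℝ} (hp : p ∈ Ioo (-(1 / 2) : ℝ) (1 / 2)) : 0 < mvnConst p := by
  refine (integral_pos_iff_support_of_nonneg (fun r ↦ sq_nonneg _)
    (integrable_mvnKernel_one_sq hp)).2 ?_
  have h : Ioo (0 : ℝ) 1 ⊆ Function.support fun r ↦ mvnKernel p 1 r ^ 2 := fun r hr ↦ by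
    have : 0 < 1 - r := by linarith [hr.2]
    simp only [Function.mem_support]
    rw [mvnKernel_of_pos hr.1, posPow_of_pos this]
    positivity
  exact lt_of_lt_of_le (by simp) (measure_mono h)

theorem integrable_mvnKernel_sq {p : ℝ} (hp : p ∈ Ioo (-(1 / 2) : ℝ) (1 / 2)) {t : ℝ}
    (ht : 0 ≤ t) : Integrable fun r ↦ mvnKernel p t r ^ 2 := by
  rcases ht.eq_or_lt with rfl | ht
  · simp [mvnKernel_zero]
  rw [← integrable_comp_mul_left_iff _ ht.ne']
  simp only [mvnKernel_mul ht, mul_pow]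
  exact (integrable_mvnKernel_one_sq hp).const_mul _

theorem integral_mvnKernel_sq {p : ℝ} {t : ℝ} (hp : p ∈ Ioo (-(1 / 2) : ℝ) (1 / 2))
    (ht : 0 ≤ t) : ∫ r, mvnKernel p t r ^ 2 = mvnConst p * t ^ (2 * p + 1) := by
  rcases ht.eq_or_lt with rfl | ht
  · rw [Real.zero_rpow (by linarith [hp.1])]
    simp [mvnKernel_zero]
  have h := Measure.integral_comp_mul_left (fun r ↦ mvnKernel p t r ^ 2) t
  simp only [mvnKernel_mul ht, mul_pow, integral_const_mul, smul_eq_mul, abs_inv,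
    abs_of_pos ht] at h
  rw [Real.rpow_add ht, Real.rpow_one, mul_comm 2 p, Real.rpow_mul ht.le, mvnConst]
  norm_cast at h ⊢
  field_simp at h
  linarith

theorem memLp_mvnKernel {p : ℝ} (hp : p ∈ Ioo (-(1 / 2) : ℝ) (1 / 2)) {t : ℝ} (ht : 0 ≤ t) :
    MemLp (mvnKernel p t) 2 :=
  (memLp_two_iff_integrable_sq (measurable_mvnKernel p t).aestronglyMeasurable).2
    (integrable_mvnKernel_sq hp ht)

/-- The covariance of fractional Brownian motion on the unit interval. -/
noncomputable def fbmKernel (H : ℝ) (s t : I) : ℝ :=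
  1 / 2 * ((s : ℝ) ^ (2 * H) + (t : ℝ) ^ (2 * H) - |(s : ℝ) - t| ^ (2 * H))

/-- The moving average representation of fractional Brownian motion. -/
theorem integral_mvnKernel_mul {p : ℝ} (hp : p ∈ Ioo (-(1 / 2) : ℝ) (1 / 2)) (s t : I) :
    ∫ r, mvnKernel p s r * mvnKernel p t r = mvnConst p * fbmKernel (p + 1 / 2) s t := by
  wlog hst : s ≤ t generalizing s t
  · have h := this t s (le_of_not_ge hst)
    simp only [fbmKernel] at h ⊢
    rw [abs_sub_comm, add_comm ((s : ℝ) ^ _), ← h]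
    exact integral_congr_ae (ae_of_all _ fun r ↦ mul_comm _ _)
  have hs0 := s.2.1
  have ht0 := t.2.1
  have hst' : 0 ≤ (t : ℝ) - s := sub_nonneg.2 hst
  -- Polarization: the increment is a translate of the kernel at `t - s`, so only the integrals of
  -- squares, known by scaling, are needed.
  have e : ∀ r, mvnKernel p s r * mvnKernel p t r = 1 / 2 * (mvnKernel p s r ^ 2 +
      mvnKernel p t r ^ 2 - mvnKernel p (t - s) (r - s) ^ 2) := fun r ↦ by
    rw [← mvnKernel_sub]; ring
  have his := integrable_mvnKernel_sq hp hs0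
  have hit := integrable_mvnKernel_sq hp ht0
  have hid := (integrable_mvnKernel_sq hp hst').comp_sub_right (s : ℝ)
  simp_rw [e]
  rw [integral_const_mul]
  have h1 := integral_sub (his.add hit) hid
  simp only [Pi.add_apply] at h1
  rw [h1, integral_add his hit,
    integral_sub_right_eq_self (fun r ↦ mvnKernel p (t - s) r ^ 2) (s : ℝ),
    integral_mvnKernel_sq hp hs0, integral_mvnKernel_sq hp ht0, integral_mvnKernel_sq hp hst',
    fbmKernel, abs_sub_comm, abs_of_nonneg hst', show 2 * (p + 1 / 2) = 2 * p + 1 by ring]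
  ring

theorem integral_sum_mvnKernel_sq {p : ℝ} (hp : p ∈ Ioo (-(1 / 2) : ℝ) (1 / 2)) (s : Finset I)
    (a : I → ℝ) : ∫ r, (∑ i ∈ s, a i * mvnKernel p i r) ^ 2 =
      mvnConst p * quadForm s a (fbmKernel (p + 1 / 2)) := by
  rw [← quadForm_const_mul]
  simp_rw [← integral_mvnKernel_mul hp]
  have h : ∀ i j : I, Integrable fun r ↦ mvnKernel p i r * mvnKernel p j r := fun i j ↦
    (memLp_mvnKernel hp i.2.1).integrable_mul (memLp_mvnKernel hp j.2.1)
  rw [quadForm_integral s a h]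
  simp_rw [quadForm_mul_self]

/-! ### Cauchy–Schwarz, Young and beta integrals -/

theorem sq_le_mul_of_forall_quadratic_nonneg {A B C : ℝ}
    (h : ∀ x : ℝ, 0 ≤ A * x ^ 2 + 2 * B * x + C) : B ^ 2 ≤ A * C := by
  have := discrim_le_zero (a := A) (b := 2 * B) (c := C) fun x ↦ by
    have := h x
    rwa [sq] at this
  rw [discrim] at this
  linarith

theorem integral_add_add {α : Type*} {mα : MeasurableSpace α} {μ : Measure α} {f g h : α → ℝ}
    (hf : Integrable f μ) (hg : Integrable g μ) (hh : Integrable h μ) :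
    ∫ x, f x + g x + h x ∂μ = ∫ x, f x ∂μ + ∫ x, g x ∂μ + ∫ x, h x ∂μ :=
  (integral_add (hf.add hg) hh).trans (congrArg (· + _) (integral_add hf hg))

theorem sq_integral_mul_le {α : Type*} {mα : MeasurableSpace α} {μ : Measure α} {f g : α → ℝ}
    (hf : MemLp f 2 μ) (hg : MemLp g 2 μ) :
    (∫ x, f x * g x ∂μ) ^ 2 ≤ (∫ x, f x ^ 2 ∂μ) * ∫ x, g x ^ 2 ∂μ := by
  refine sq_le_mul_of_forall_quadratic_nonneg fun c ↦ ?_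
  have h1 := hf.integrable_sq.mul_const (c ^ 2)
  have h2 := (hf.integrable_mul hg).const_mul (2 * c)
  have h3 := hg.integrable_sq
  have h : 0 ≤ ∫ x, (f x * c + g x) ^ 2 ∂μ := integral_nonneg fun x ↦ sq_nonneg _
  have e : (fun x ↦ (f x * c + g x) ^ 2) =
      fun x ↦ (f x ^ 2 * c ^ 2 + 2 * c * (f * g) x) + g x ^ 2 := by
    ext x; simp only [Pi.mul_apply]; ring
  rw [e, integral_add_add h1 h2 h3, integral_mul_const,
    integral_const_mul] at h
  simp only [Pi.mul_apply] at h
  linarith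

/-- A bilinear form of Young's inequality `L¹ * L² ⊆ L²`. -/
theorem sq_integral_mul_conv_le {h k g : ℝ → ℝ} (hh : MemLp h 2) (hg : MemLp g 2)
    (hk : Integrable k) (hk0 : ∀ x, 0 ≤ k x) :
    Integrable (fun q : ℝ × ℝ ↦ h q.1 * k (q.1 - q.2) * g q.2) ∧
    (∫ q : ℝ × ℝ, h q.1 * k (q.1 - q.2) * g q.2) ^ 2 ≤
      (∫ x, k x) ^ 2 * (∫ x, g x ^ 2) * ∫ x, h x ^ 2 := by
  have hg2 : Integrable (fun q : ℝ × ℝ ↦ g q.2 ^ 2 * k (q.1 - q.2)) := by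
    simpa [Measure.volume_eq_prod] using! hg.integrable_sq.convolution_integrand (ContinuousLinearMap.mul ℝ ℝ) hk
  -- Reflecting `k` and swapping the two variables reduces this to the previous case.
  have hh2 : Integrable (fun q : ℝ × ℝ ↦ h q.1 ^ 2 * k (q.1 - q.2)) := by
    have := hh.integrable_sq.convolution_integrand (ContinuousLinearMap.mul ℝ ℝ) hk.comp_neg
    simpa using! this.swap
  have hgi : ∫ q : ℝ × ℝ, g q.2 ^ 2 * k (q.1 - q.2) = (∫ x, k x) * ∫ x, g x ^ 2 := by
    rw [Measure.volume_eq_prod, integral_prod_symm _ hg2]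
    simp only [integral_const_mul, integral_sub_right_eq_self, integral_mul_const]
    ring
  have hhi : ∫ q : ℝ × ℝ, h q.1 ^ 2 * k (q.1 - q.2) = (∫ x, k x) * ∫ x, h x ^ 2 := by
    rw [Measure.volume_eq_prod, integral_prod _ hh2]
    simp only [integral_const_mul, integral_sub_left_eq_self, integral_mul_const]
    ring
  have hint : Integrable (fun q : ℝ × ℝ ↦ h q.1 * k (q.1 - q.2) * g q.2) := by
    refine Integrable.mono' (hg2.add hh2) ?_ (ae_of_all _ fun q ↦ ?_)
    · refine (hh.1.comp_fst.mul ?_).mul hg.1.comp_snd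
      exact hk.1.comp_quasiMeasurePreserving (quasiMeasurePreserving_sub_of_right_invariant _ _)
    · simp only [Pi.add_apply, norm_mul, Real.norm_eq_abs, abs_of_nonneg (hk0 _)]
      have := hk0 (q.1 - q.2)
      rw [← sq_abs (g q.2), ← sq_abs (h q.1)]
      nlinarith [mul_nonneg this (sq_nonneg (|g q.2| - |h q.1|)),
        mul_nonneg this (sq_nonneg (|g q.2| + |h q.1|))]
  refine ⟨hint, ?_⟩
  -- Cauchy–Schwarz for the weight `k(x - y)`, both of whose marginals are the constant `∫ k`.
  refine (sq_le_mul_of_forall_quadratic_nonneg (A := (∫ x, k x) * ∫ x, h x ^ 2)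
    (C := (∫ x, k x) * ∫ x, g x ^ 2) fun c ↦ ?_).trans_eq (by ring)
  have h0 : 0 ≤ ∫ q : ℝ × ℝ, (h q.1 * c + g q.2) ^ 2 * k (q.1 - q.2) :=
    integral_nonneg fun q ↦ mul_nonneg (sq_nonneg _) (hk0 _)
  have e : (fun q : ℝ × ℝ ↦ (h q.1 * c + g q.2) ^ 2 * k (q.1 - q.2)) = fun q ↦
      (h q.1 ^ 2 * k (q.1 - q.2) * c ^ 2 + 2 * c * (h q.1 * k (q.1 - q.2) * g q.2))
        + g q.2 ^ 2 * k (q.1 - q.2) := by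
    ext q; ring
  have h1 := hh2.mul_const (c ^ 2)
  have h2 := hint.const_mul (2 * c)
  rw [e, integral_add_add h1 h2 hg2, integral_mul_const,
    integral_const_mul, hhi, hgi] at h0
  linarith

theorem integral_rpow_mul_sub_rpow {α β t : ℝ} (hα : 0 < α) (hβ : 0 < β) (ht : 0 < t) :
    ∫ x in (0 : ℝ)..t, x ^ (α - 1) * (t - x) ^ (β - 1) = beta α β * t ^ (α + β - 1) := by
  have h := Complex.betaIntegral_scaled α β ht
  have hb : Complex.betaIntegral α β = (beta α β : ℂ) := by
    rw [Complex.betaIntegral_eq_Gamma_mul_div _ _ (by simpa) (by simpa), beta,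
      ← Complex.ofReal_add, Complex.Gamma_ofReal, Complex.Gamma_ofReal, Complex.Gamma_ofReal]
    norm_cast
  have hl : ∫ x in (0 : ℝ)..t, (x : ℂ) ^ ((α : ℂ) - 1) * ((t : ℂ) - x) ^ ((β : ℂ) - 1) =
      ((∫ x in (0 : ℝ)..t, x ^ (α - 1) * (t - x) ^ (β - 1) : ℝ) : ℂ) := by
    rw [← intervalIntegral.integral_ofReal]
    refine intervalIntegral.integral_congr fun x hx ↦ ?_
    rw [uIcc_of_le ht.le] at hx
    simp only [Complex.ofReal_mul]
    rw [Complex.ofReal_cpow hx.1, Complex.ofReal_cpow (sub_nonneg.2 hx.2)]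
    push_cast
    rfl
  rw [hl, hb, show (α : ℂ) + β - 1 = ((α + β - 1 : ℝ) : ℂ) by push_cast; rfl,
    ← Complex.ofReal_cpow ht.le] at h
  rw [mul_comm]
  exact_mod_cast h

/-- The convolution of `x_+^q` and `x_+^p` is a multiple of `x_+^(p+q+1)`. -/
theorem integral_posPow_mul_posPow {p q : ℝ} (hp : -1 < p) (hq : -1 < q) (s t : ℝ) :
    ∫ r, posPow q (r - s) * posPow p (t - r) =
      beta (q + 1) (p + 1) * posPow (p + q + 1) (t - s) := by
  rw [← integral_add_right_eq_self _ s]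
  simp only [add_sub_cancel_right]
  rcases lt_or_ge s t with hst | hst
  · have hts : 0 < t - s := sub_pos.2 hst
    have h := integral_rpow_mul_sub_rpow (α := q + 1) (β := p + 1) (by linarith) (by linarith) hts
    rw [posPow_of_pos hts, show p + q + 1 = q + 1 + (p + 1) - 1 by ring, ← h,
      intervalIntegral.integral_of_le hts.le, integral_Ioc_eq_integral_Ioo,
      ← integral_indicator measurableSet_Ioo]
    congr 1
    ext r
    by_cases hr : r ∈ Ioo 0 (t - s)
    · rw [indicator_of_mem hr, posPow_of_pos hr.1, posPow_of_pos (by linarith [hr.2])]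
      ring_nf
    · rw [indicator_of_notMem hr]
      rcases le_or_gt r 0 with h0 | h0
      · rw [posPow_of_nonpos h0, zero_mul]
      · have h1 : t - s ≤ r := not_lt.1 fun h1 ↦ hr ⟨h0, h1⟩
        rw [posPow_of_nonpos (x := t - (r + s)) (by linarith), mul_zero]
  · rw [posPow_of_nonpos (x := t - s) (by linarith), mul_zero]
    refine integral_eq_zero_of_ae (ae_of_all _ fun r ↦ ?_)
    rcases le_or_gt r 0 with h0 | h0
    · simp [posPow_of_nonpos h0]
    · simp [posPow_of_nonpos (x := t - (r + s)) (by linarith)]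

/-! ### Elements of the RKHS of fractional Brownian motion -/

section fbm

variable {H : ℝ}

theorem sub_half_mem_Ioo (hH : H ∈ Ioo (0 : ℝ) 1) :
    H - 1 / 2 ∈ Ioo (-(1 / 2) : ℝ) (1 / 2) :=
  ⟨by linarith [hH.1], by linarith [hH.2]⟩

theorem integral_sum_sq_eq_fbmKernel (hH : H ∈ Ioo (0 : ℝ) 1) (s : Finset I) (a : I → ℝ) :
    ∫ r, (∑ i ∈ s, a i * mvnKernel (H - 1 / 2) i r) ^ 2 =
      mvnConst (H - 1 / 2) * quadForm s a (fbmKernel H) := by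
  rw [integral_sum_mvnKernel_sq (sub_half_mem_Ioo hH), sub_add_cancel]

theorem memLp_sum_mvnKernel (hH : H ∈ Ioo (0 : ℝ) 1) (s : Finset I) (a : I → ℝ) :
    MemLp (fun r ↦ ∑ i ∈ s, a i * mvnKernel (H - 1 / 2) i r) 2 :=
  memLp_finsetSum _ fun i _ ↦ (memLp_mvnKernel (sub_half_mem_Ioo hH) i.2.1).const_mul (a i)

theorem isPosKernel_fbmKernel (hH : H ∈ Ioo (0 : ℝ) 1) : IsPosKernel (fbmKernel H) where
  symm i j := by simp only [fbmKernel]; rw [abs_sub_comm, add_comm ((i : ℝ) ^ _)]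
  nonneg s a := by
    refine nonneg_of_mul_nonneg_right (a := mvnConst (H - 1 / 2)) ?_
      (mvnConst_pos (sub_half_mem_Ioo hH))
    rw [← integral_sum_sq_eq_fbmKernel hH]
    exact integral_nonneg fun r ↦ sq_nonneg _

/-- The variance function `t ↦ t^{2H}` lies in the reproducing kernel Hilbert space of fractional
Brownian motion on the unit interval. -/
theorem exists_kernelBound_fbm_variance (hH : H ∈ Ioo (0 : ℝ) 1) :
    ∃ M, 0 < M ∧ KernelBound (fbmKernel H) (fun t ↦ (t : ℝ) ^ (2 * H)) M := by
  have hp := sub_half_mem_Ioo hH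
  set p := H - 1 / 2
  -- The representer of `t^{2H}`, up to a constant: convolving `x_+^p` with itself gives a multiple
  -- of `x_+^{2p+1}`, and `2p + 1 = 2H`. The cutoff at 1 is harmless since the kernel at `t ≤ 1`
  -- vanishes beyond 1.
  let g : ℝ → ℝ := (Ioc 0 1).indicator (posPow p)
  have hg : MemLp g 2 := by
    rw [memLp_two_iff_integrable_sq
      ((measurable_posPow p).indicator measurableSet_Ioc).aestronglyMeasurable]
    have h := (integrable_indicator_iff measurableSet_Ioc).2
      (integrableOn_posPow (p := 2 * p) (by linarith [hp.1]) 0 1)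
    refine h.congr (ae_of_all _ fun r ↦ ?_)
    by_cases hr : r ∈ Ioc (0 : ℝ) 1
    · simp [hr, posPow_sq]
    · simp [hr]
  have hb : 0 < beta (p + 1) (p + 1) := beta_pos (by linarith [hp.1]) (by linarith [hp.1])
  set b := beta (p + 1) (p + 1)
  have hval : ∀ t : I, ∫ r, mvnKernel p t r * g r = b * (t : ℝ) ^ (2 * H) := fun t ↦ by
    have e : ∀ r, mvnKernel p t r * g r = posPow p (r - 0) * posPow p (t - r) := fun r ↦ by
      rcases le_or_gt r 0 with h0 | h0
      · simp [g, h0.not_gt, posPow_of_nonpos h0]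
      rw [mvnKernel_of_pos h0, sub_zero]
      rcases le_or_gt r 1 with h1 | h1
      · simp [g, h0, h1, mul_comm]
      · simp [posPow_of_nonpos (x := t - r) (by linarith [t.2.2])]
    simp_rw [e]
    rw [integral_posPow_mul_posPow (by linarith [hp.1]) (by linarith [hp.1]), sub_zero,
      show p + p + 1 = 2 * H by simp only [p]; ring]
    rcases t.2.1.eq_or_lt with h0 | h0
    · rw [← h0, posPow_of_nonpos le_rfl, Real.zero_rpow (by linarith [hH.1])]
    · rw [posPow_of_pos h0]
  set G := ∫ r, g r ^ 2
  have hG : 0 ≤ G := integral_nonneg fun r ↦ sq_nonneg _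
  have hC := mvnConst_pos hp
  -- `G + 1` instead of `G` makes the constant visibly positive.
  refine ⟨(G + 1) * mvnConst p / b ^ 2, by positivity, fun s a ↦ ?_⟩
  have h := sq_integral_mul_le (memLp_sum_mvnKernel hH s a) hg
  rw [integral_sum_sq_eq_fbmKernel hH] at h
  have hsum : ∫ r, (∑ i ∈ s, a i * mvnKernel p i r) * g r =
      b * ∑ i ∈ s, a i * (i : ℝ) ^ (2 * H) := by
    simp_rw [Finset.sum_mul, mul_assoc]
    have hi : ∀ i : I, Integrable fun r ↦ mvnKernel p i r * g r := fun i ↦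
      (memLp_mvnKernel hp i.2.1).integrable_mul hg
    rw [integral_finsetSum _ fun i _ ↦ (hi i).const_mul (a i), Finset.mul_sum]
    refine Finset.sum_congr rfl fun i _ ↦ ?_
    rw [integral_const_mul, hval]
    ring
  rw [hsum, mul_pow] at h
  have hq := (isPosKernel_fbmKernel hH).nonneg s a
  rw [div_mul_eq_mul_div, le_div_iff₀ (by positivity), mul_comm]
  refine h.trans ?_
  have := mul_nonneg hC.le hq
  change mvnConst p * _ * G ≤ _
  linarith

/-- The image of `I^{3/2}` is contained in the reproducing kernel Hilbert space of fractional
Brownian motion on the unit interval. -/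
theorem exists_kernelBound_of_mem_fracImage (hH : H ∈ Ioo (0 : ℝ) 1) {f : I → ℝ}
    (hf : f ∈ fracImage (3 / 2)) : ∃ C, 0 ≤ C ∧ KernelBound (fbmKernel H) f C := by
  obtain ⟨g, hg, hf⟩ := hf
  have hp := sub_half_mem_Ioo hH
  set p := H - 1 / 2
  -- The kernel of `I^{1-H}`, up to a constant; convolved with `x_+^p` it gives a multiple of
  -- `x_+^{1/2}`, the kernel of `I^{3/2}`. Restricting to `(0,1]` makes it integrable and loses
  -- nothing, as only `0 < s < r < t ≤ 1` contributes.
  let k : ℝ → ℝ := (Ioc 0 1).indicator (posPow (-H))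
  have hk : Integrable k := (integrable_indicator_iff measurableSet_Ioc).2
    (integrableOn_posPow (by linarith [hH.2]) 0 1)
  have hk0 : ∀ x, 0 ≤ k x := fun x ↦ indicator_nonneg (fun x _ ↦ posPow_nonneg _ x) x
  let G : ℝ → ℝ := (Ioc 0 1).indicator g
  have hG : MemLp G 2 := (memLp_indicator_iff_restrict measurableSet_Ioc).2
    (hg.mono_measure (Measure.restrict_mono Ioc_subset_Icc_self le_rfl))
  have hb : 0 < beta (-H + 1) (p + 1) := beta_pos (by linarith [hH.2]) (by linarith [hp.1])
  set b := beta (-H + 1) (p + 1)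
  have hint : ∀ t : I, Integrable fun q : ℝ × ℝ ↦ mvnKernel p t q.1 * k (q.1 - q.2) * G q.2 :=
    fun t ↦ (sq_integral_mul_conv_le (memLp_mvnKernel hp t.2.1) hG hk hk0).1
  have hinner : ∀ (t : I) (s : ℝ), ∫ r, mvnKernel p t r * k (r - s) * G s =
      b * ((Ioc (0 : ℝ) t).indicator (fun s ↦ (t - s : ℝ) ^ (3 / 2 - 1 : ℝ) * g s) s) := by
    intro t s
    rw [integral_mul_const]
    by_cases hs : s ∈ Ioc (0 : ℝ) 1
    · have e : ∀ r, mvnKernel p t r * k (r - s) = posPow (-H) (r - s) * posPow p (t - r) := by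
        intro r
        rcases le_or_gt (r - s) 0 with h0 | h0
        · simp [k, sub_nonpos.1 h0, posPow_of_nonpos h0]
        rw [mvnKernel_of_pos (by linarith [hs.1])]
        rcases le_or_gt (r - s) 1 with h1 | h1
        · rw [mul_comm]
          simp only [k]
          rw [indicator_of_mem (show r - s ∈ Ioc (0 : ℝ) 1 from ⟨h0, h1⟩)]
        · simp [posPow_of_nonpos (x := t - r) (by linarith [t.2.2, hs.1])]
      simp_rw [e]
      rw [integral_posPow_mul_posPow (by linarith [hp.1]) (by linarith [hH.2]),
        show p + -H + 1 = 3 / 2 - 1 by simp only [p]; ring]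
      simp only [G]
      rw [indicator_of_mem hs, mul_assoc]
      congr 1
      rcases lt_trichotomy s t with h | h | h
      · rw [posPow_of_pos (sub_pos.2 h), indicator_of_mem (show s ∈ Ioc (0 : ℝ) t from ⟨hs.1, h.le⟩)]
      · subst h
        rw [indicator_of_mem (show (t : ℝ) ∈ Ioc (0 : ℝ) t from ⟨hs.1, le_rfl⟩), sub_self, posPow_of_nonpos le_rfl,
          Real.zero_rpow (by norm_num)]
      · rw [posPow_of_nonpos (by linarith), indicator_of_notMem fun h' ↦ h'.2.not_gt h, zero_mul]
    · have h1 : s ∉ Ioc (0 : ℝ) t := fun h ↦ hs ⟨h.1, h.2.trans t.2.2⟩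
      simp [G, indicator_of_notMem hs, indicator_of_notMem h1]
  have hval : ∀ t : I, ∫ q : ℝ × ℝ, mvnKernel p t q.1 * k (q.1 - q.2) * G q.2 =
      b * Real.Gamma (3 / 2) * f t := by
    intro t
    have hΓ := (Real.Gamma_pos_of_pos (s := 3 / 2) (by norm_num)).ne'
    rw [Measure.volume_eq_prod, integral_prod_symm _ (hint t)]
    simp only [hinner]
    rw [integral_const_mul, integral_indicator measurableSet_Ioc, hf, fracIntegral,
      intervalIntegral.integral_of_le t.2.1]
    field_simp
  have hΓ := Real.Gamma_pos_of_pos (s := 3 / 2) (by norm_num)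
  set c := b * Real.Gamma (3 / 2)
  have hc : 0 < c := by positivity
  have hC := mvnConst_pos hp
  have hG2 : 0 ≤ ∫ x, G x ^ 2 := integral_nonneg fun r ↦ sq_nonneg _
  refine ⟨(∫ x, k x) ^ 2 * (∫ x, G x ^ 2) * mvnConst p / c ^ 2, by positivity, fun s a ↦ ?_⟩
  have h := (sq_integral_mul_conv_le (memLp_sum_mvnKernel hH s a) hG hk hk0).2
  rw [integral_sum_sq_eq_fbmKernel hH] at h
  have hsum : ∫ q : ℝ × ℝ, (∑ i ∈ s, a i * mvnKernel p i q.1) * k (q.1 - q.2) * G q.2 =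
      c * ∑ i ∈ s, a i * f i := by
    simp_rw [Finset.sum_mul, mul_assoc]
    simp_rw [mul_assoc] at hint hval
    rw [integral_finsetSum _ fun i _ ↦ (hint i).const_mul (a i), Finset.mul_sum]
    refine Finset.sum_congr rfl fun i _ ↦ ?_
    rw [integral_const_mul, hval]
    ring
  rw [hsum, mul_pow] at h
  rw [div_mul_eq_mul_div, le_div_iff₀ (by positivity), mul_comm]
  refine h.trans_eq ?_
  ring

end fbm

/-! ### Comparison of the processes -/

section process

variable {Ω : Type*} {mΩ : MeasurableSpace Ω} {P : Measure Ω} {X : ℝ≥0 → Ω → ℝ} {H K : ℝ}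

theorem IsFBm.covFun_eq (hX : IsFBm H X P) :
    covFun (fun t : I ↦ X (unitInterval.toNNReal t)) P = fbmKernel H := by
  ext s t
  simpa [covFun, fbmKernel] using hX.cov (unitInterval.toNNReal t) (unitInterval.toNNReal s)

theorem add_sub_two_mul_fbmKernel (s t : I) :
    (s : ℝ) ^ (2 * H) + (t : ℝ) ^ (2 * H) - 2 * fbmKernel H s t = |(s : ℝ) - t| ^ (2 * H) := by
  rw [fbmKernel]
  ring

theorem IsBiFBm.covFun_eq (hX : IsBiFBm H K X P) :
    covFun (fun t : I ↦ X (unitInterval.toNNReal t)) P = fun s t : I ↦ 1 / (2 : ℝ) ^ K *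
      (((s : ℝ) ^ (2 * H) + (t : ℝ) ^ (2 * H)) ^ K -
        ((s : ℝ) ^ (2 * H) + (t : ℝ) ^ (2 * H) - 2 * fbmKernel H s t) ^ K) := by
  ext s t
  rw [add_sub_two_mul_fbmKernel, ← Real.rpow_mul (abs_nonneg _)]
  simpa [covFun] using hX.cov (unitInterval.toNNReal t) (unitInterval.toNNReal s)

theorem mem_unitRKHS_iff (hX : IsFBm H X P) {f : I → ℝ} :
    f ∈ unitRKHS hX.isGaussianProcess ↔ ∃ C, 0 ≤ C ∧ KernelBound (fbmKernel H) f C := by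
  rw [unitRKHS, mem_processRKHS_iff, hX.covFun_eq]

theorem unitRKHS_fbm_subset_bifbm {Ω' : Type*} {mΩ' : MeasurableSpace Ω'} {P' : Measure Ω'}
    {Z : ℝ≥0 → Ω' → ℝ} (hH : H ∈ Ioo (0 : ℝ) 1) (hK : K ∈ Ioo (0 : ℝ) 1) (hX : IsFBm H X P)
    (hZ : IsBiFBm H K Z P') :
    unitRKHS hX.isGaussianProcess ⊆ unitRKHS hZ.isGaussianProcess := by
  obtain ⟨M, hM, hu⟩ := exists_kernelBound_fbm_variance hH
  obtain ⟨C, hC, h⟩ := exists_quadForm_le_rpow_sub hK (isPosKernel_fbmKernel hH) hu hM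
    (fun t ↦ Real.rpow_nonneg t.2.1 _) fun s t ↦ by
      rw [add_sub_two_mul_fbmKernel]; positivity
  refine processRKHS_subset _ _ (C := C * 2 ^ K) (by positivity) fun s a ↦ ?_
  rw [hX.covFun_eq, hZ.covFun_eq, quadForm_const_mul]
  refine (h s a).trans_eq ?_
  field_simp

theorem unitRKHS_bifbm_subset_fbm {Ω' : Type*} {mΩ' : MeasurableSpace Ω'} {P' : Measure Ω'}
    {Z : ℝ≥0 → Ω' → ℝ} (hK : K ∈ Ioo (0 : ℝ) 1) (hX : IsFBm (H * K) X P)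
    (hZ : IsBiFBm H K Z P') :
    unitRKHS hZ.isGaussianProcess ⊆ unitRKHS hX.isGaussianProcess := by
  -- This constant makes the `|s-t|^{2HK}` terms cancel, leaving `2^{-K}(u_s^K + u_t^K -
  -- (u_s+u_t)^K)`.
  refine processRKHS_subset _ _ (C := 2 / 2 ^ K) (by positivity) fun s a ↦ ?_
  have h := (isPosKernel_rpow_add_sub (u := fun t : I ↦ (t : ℝ) ^ (2 * H)) hK
    fun t ↦ Real.rpow_nonneg t.2.1 _).const_mul (c := 1 / (2 : ℝ) ^ K) (by positivity)
  rw [hX.covFun_eq, hZ.covFun_eq, ← sub_nonneg, ← quadForm_const_mul s a _ (2 / 2 ^ K),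
    ← quadForm_sub]
  refine (h.nonneg s a).trans_eq (congrArg _ (funext fun s ↦ funext fun t ↦ ?_))
  rw [add_sub_two_mul_fbmKernel, ← Real.rpow_mul (abs_nonneg _), ← Real.rpow_mul s.2.1,
    ← Real.rpow_mul t.2.1, fbmKernel, show 2 * (H * K) = 2 * H * K by ring]
  ring

theorem fracImage_subset_unitRKHS_fbm (hH : H ∈ Ioo (0 : ℝ) 1) (hX : IsFBm H X P) :
    fracImage (3 / 2) ⊆ unitRKHS hX.isGaussianProcess := fun _ hf ↦
  (mem_unitRKHS_iff hX).2 (exists_kernelBound_of_mem_fracImage hH hf)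

end process

end BiFBm

theorem mainTheorem7 {Ω₁ Ω₂ Ω₃ : Type*}
    {m₁ : MeasurableSpace Ω₁} {m₂ : MeasurableSpace Ω₂} {m₃ : MeasurableSpace Ω₃}
    (P₁ : Measure Ω₁) (P₂ : Measure Ω₂) (P₃ : Measure Ω₃)
    [IsProbabilityMeasure P₁] [IsProbabilityMeasure P₂] [IsProbabilityMeasure P₃]
    (H K : ℝ) (hH : H ∈ Ioo (0 : ℝ) 1) (hK : K ∈ Ioo (0 : ℝ) 1)
    (B : ℝ≥0 → Ω₁ → ℝ) (Z : ℝ≥0 → Ω₂ → ℝ) (B' : ℝ≥0 → Ω₃ → ℝ)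
    (hB : BiFBm.IsFBm H B P₁) (hZ : BiFBm.IsBiFBm H K Z P₂) (hB' : BiFBm.IsFBm (H * K) B' P₃) :
    BiFBm.unitRKHS hB.isGaussianProcess ⊆ BiFBm.unitRKHS hZ.isGaussianProcess ∧
    BiFBm.unitRKHS hZ.isGaussianProcess ⊆ BiFBm.unitRKHS hB'.isGaussianProcess ∧
    BiFBm.fracImage (3 / 2) ⊆ BiFBm.unitRKHS hB.isGaussianProcess ∧
    BiFBm.fracImage (3 / 2) ⊆ BiFBm.unitRKHS hZ.isGaussianProcess := by
  have h₁ := BiFBm.unitRKHS_fbm_subset_bifbm hH hK hB hZ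
  have h₂ := BiFBm.fracImage_subset_unitRKHS_fbm hH hB
  exact ⟨h₁, BiFBm.unitRKHS_bifbm_subset_fbm hK hB' hZ, h₂, h₂.trans h₁⟩
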